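/- Let $d\ge 1$ and let $V:\mathbb{R}^d\to\mathbb{R}$ be a real-valued Lebesgue measurable function. Let $(1-\Delta)^{-1/2}$ be the bounded operator on $L^2(\mathbb{R}^d;\mathbb{C})$ that acts as multiplication by $(1+|\xi|^2)^{-1/2}$ on the Fourier side, and let $V$ act by multiplication. Consider the assumptions (A1) $V(-x)=V(x)$; (A2) $V(1-\Delta)^{-1/2}$ is a bounded operator on $L^2(\mathbb{R}^d;\mathbb{C})$ (in particular, it is defined on all of $L^2$); (A3) $(1-\Delta)^{-1/2}V(1-\Delta)^{-1/2}$ is a compact operator on $L^2(\mathbb{R}^d;\mathbb{C})$. For $0<p<\infty$, let $L^{p,\infty}(\mathbb{R}^d)$ be the set of measurable functions $f$ for which there is $c>0$ such that the Lebesgue measure of $\{x:|f(x)|>t\}$ is at most $c^p/t^p$ for all $t>0$. Let $L^p(\mathbb{R}^d)+L^\infty_0(\mathbb{R}^d)$ be the set of measurable functions $f$ for which there is a sequence $(f_n)$ in $L^p(\mathbb{R}^d)$ with $\lim_{n\to\infty}\|f-f_n\|_{L^\infty}=0$. Then $V$ satisfies (A2) and (A3) in each of the following cases: - $d=1$ and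 $V\in L^2(\mathbb{R})+L^\infty_0(\mathbb{R})$; - $d=2$ and $V\in L^p(\mathbb{R}^2)+L^\infty_0(\mathbb{R}^2)$ for some $p$ with $2<p<\infty$; - $d\ge 3$ and $V\in L^{d,\infty}(\mathbb{R}^d)$. In particular, in dimension $d=3$ each of the two Coulomb potentials $V(x)=\frac{1}{|x|}$ and $V(x)=-\frac{1}{|x|}$ satisfies (A1), (A2) and (A3). -/

import Mathlib

open MeasureTheory Filter
open scoped ENNReal Topology FourierTransform

noncomputable section

/-- Euclidean space of dimension `d`. -/
abbrev RSpace (d : ℕ) : Type := EuclideanSpace ℝ (Fin d)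

/-- The one-particle Hilbert space `L²(ℝ^d; ℂ)`. -/
abbrev L2Space (d : ℕ) : Type := Lp ℂ 2 (volume : Measure (RSpace d))

/-- The symbol of `(1 - Δ)^{-1/2}`. Mathlib's Fourier transform has the kernel
`exp (-2 π i ⟨x, ξ⟩)`, so that `-Δ` has the symbol `(2 π ‖ξ‖)^2`. -/
def invSqrtSymbol (d : ℕ) (ξ : RSpace d) : ℂ :=
  (((1 + (2 * Real.pi * ‖ξ‖) ^ 2) ^ (-(1 / 2) : ℝ) : ℝ) : ℂ)

theorem memLp_invSqrtSymbol (d : ℕ) :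
    MemLp (invSqrtSymbol d) ∞ (volume : Measure (RSpace d)) := by
  refine memLp_top_of_bound (C := 1) ?_ (ae_of_all _ fun ξ => ?_)
  · refine Continuous.aestronglyMeasurable ?_
    unfold invSqrtSymbol
    refine Complex.continuous_ofReal.comp ?_
    refine Continuous.rpow_const (by fun_prop) fun ξ => Or.inl ?_
    positivity
  · unfold invSqrtSymbol
    rw [Complex.norm_real, Real.norm_eq_abs, abs_of_nonneg (by positivity)]
    refine Real.rpow_le_one_of_one_le_of_nonpos ?_ (by norm_num)
    have : 0 ≤ (2 * Real.pi * ‖ξ‖) ^ 2 := sq_nonneg _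
    linarith

/-- Multiplication by the symbol of `(1 - Δ)^{-1/2}`, as a bounded operator on `L²(ℝ^d; ℂ)`. -/
def invSqrtSymbolMul (d : ℕ) : L2Space d →L[ℂ] L2Space d :=
  (ContinuousLinearMap.mul ℂ ℂ).holderL volume ∞ 2 2 ((memLp_invSqrtSymbol d).toLp)

/-- The operator `(1 - Δ)^{-1/2}` on `L²(ℝ^d; ℂ)`: the Fourier multiplier with the symbol
of `(1 - Δ)^{-1/2}`. -/
def invSqrtLaplacian (d : ℕ) : L2Space d →L[ℂ] L2Space d :=
  ((Lp.fourierTransformₗᵢ (RSpace d) ℂ).symm.toContinuousLinearEquiv :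
      L2Space d →L[ℂ] L2Space d) ∘L
    invSqrtSymbolMul d ∘L
    ((Lp.fourierTransformₗᵢ (RSpace d) ℂ).toContinuousLinearEquiv :
      L2Space d →L[ℂ] L2Space d)

/-- `f ∈ L^{p,∞}(ℝ^d)` (weak `L^p`), for `0 < p < ∞`. -/
def MemWeakLp {d : ℕ} (f : RSpace d → ℝ) (p : ℝ) : Prop :=
  AEStronglyMeasurable f volume ∧
    ∃ c : ℝ, 0 < c ∧ ∀ t : ℝ, 0 < t →
      volume {x : RSpace d | t < |f x|} ≤ ENNReal.ofReal (c ^ p / t ^ p)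

/-- `f ∈ L^p(ℝ^d) + L^∞_0(ℝ^d)`: `f` is a limit, in the `L^∞` norm, of functions in `L^p`. -/
def MemLpAddLinfZero {d : ℕ} (f : RSpace d → ℝ) (p : ℝ≥0∞) : Prop :=
  AEStronglyMeasurable f volume ∧
    ∃ g : ℕ → RSpace d → ℝ, (∀ n, MemLp (g n) p volume) ∧
      Tendsto (fun n => eLpNorm (f - g n) ∞ volume) atTop (𝓝 0)

/-- Assumption (A1): the (real-valued) potential is even. -/
def PotentialEven {d : ℕ} (V : RSpace d → ℝ) : Prop :=
  ∀ x, V (-x) = V x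

/-- Assumption (A2): `V (1 - Δ)^{-1/2}` is a bounded operator on `L²(ℝ^d; ℂ)`, where `V` acts by
multiplication. In particular `V · (1 - Δ)^{-1/2} u` lies in `L²` for every `u` in `L²`. -/
def PotentialBounded {d : ℕ} (V : RSpace d → ℝ) : Prop :=
  ∃ T : L2Space d →L[ℂ] L2Space d,
    ∀ u : L2Space d, (T u : RSpace d → ℂ) =ᵐ[volume]
      fun x => (V x : ℂ) * (invSqrtLaplacian d u : RSpace d → ℂ) x

/-- Assumption (A3): `(1 - Δ)^{-1/2} V (1 - Δ)^{-1/2}` is a compact operator on `L²(ℝ^d; ℂ)`: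
there is a compact operator `K` such that for every `u` in `L²` the product
`V · (1 - Δ)^{-1/2} u` is an `L²` function `w`, and `K u = (1 - Δ)^{-1/2} w`. -/
def PotentialCompact {d : ℕ} (V : RSpace d → ℝ) : Prop :=
  ∃ K : L2Space d →L[ℂ] L2Space d, IsCompactOperator K ∧
    ∀ u : L2Space d, ∃ w : L2Space d,
      ((w : RSpace d → ℂ) =ᵐ[volume]
        fun x => (V x : ℂ) * (invSqrtLaplacian d u : RSpace d → ℂ) x) ∧
      K u = invSqrtLaplacian d w

end

/-! Write `m` for the symbol of `(1 - Δ)^{-1/2}`. Since `‖m ξ‖ ‖ξ‖ ≤ 1`, it lies in weak `L^p` for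
every `p ≥ d`, so the boundedness of `V m(D)` for `V` in weak `L^p` with `p > 2` is a weak form of
Cwikel's estimate. On the level set `{|V| > t}`, cut the frequencies at `‖m‖ = 1 / t`: the low
frequencies are estimated in `L^∞` by Cauchy–Schwarz and the high ones in `L²` by Plancherel, and
integrating the result against `t dt` gives the norm of `V m(D) u` by the layer cake formula.

If `V` and `m` are both square integrable, then `V m(D)` is Hilbert–Schmidt; this is the case
`d = 1`, and it also drives compactness: `m` tends to zero at infinity, hence is a uniform limit of
symbols with bounded support, and every potential in the statement is, up to an arbitrarily small
bounded error, square integrable.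
-/

noncomputable section

open ContinuousLinearMap
open scoped InnerProductSpace InnerProduct

theorem isCompactOperator_of_forall_exists_norm_sub_le {𝕜 E F : Type*}
    [NontriviallyNormedField 𝕜] [NormedAddCommGroup E] [NormedSpace 𝕜 E]
    [NormedAddCommGroup F] [NormedSpace 𝕜 F] [CompleteSpace F] {T : E →L[𝕜] F}
    (h : ∀ ε : ℝ, 0 < ε → ∃ S : E →L[𝕜] F, IsCompactOperator S ∧ ‖T - S‖ ≤ ε) :
    IsCompactOperator T := by
  refine isClosed_setOfPred_isCompactOperator.closure_subset <|
    Metric.mem_closure_iff.2 fun ε hε => ?_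
  obtain ⟨S, hS, hTS⟩ := h (ε / 2) (half_pos hε)
  exact ⟨S, hS, (dist_eq_norm T S).trans_le hTS |>.trans_lt (half_lt_self hε)⟩

theorem eLpNorm_two_sq {α E : Type*} [MeasurableSpace α] {μ : Measure α} [NormedAddCommGroup E]
    (f : α → E) : eLpNorm f 2 μ ^ 2 = ∫⁻ x, ‖f x‖ₑ ^ 2 ∂μ := by
  simpa using eLpNorm_nnreal_pow_eq_lintegral (μ := μ) (f := f) (p := 2) two_ne_zero

section MulOp

variable {α : Type*} [MeasurableSpace α] {μ : Measure α} {m n : α → ℂ}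

/-- Multiplication by the essentially bounded function `m`, as an operator on `L²`. -/
def mulOp (hm : MemLp m ∞ μ) : Lp ℂ 2 μ →L[ℂ] Lp ℂ 2 μ :=
  (ContinuousLinearMap.mul ℂ ℂ).holderL μ ∞ 2 2 hm.toLp

theorem coeFn_mulOp (hm : MemLp m ∞ μ) (u : Lp ℂ 2 μ) : mulOp hm u =ᵐ[μ] fun x => m x * u x := by
  filter_upwards [(ContinuousLinearMap.mul ℂ ℂ).coeFn_holder (r := 2) hm.toLp u, hm.coeFn_toLp]
    with x hx hmx
  exact hx.trans (by rw [mul_apply', hmx])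

theorem norm_mulOp_le (hm : MemLp m ∞ μ) {C : ℝ} (hC : 0 ≤ C) (h : ∀ᵐ x ∂μ, ‖m x‖ ≤ C) :
    ‖mulOp hm‖ ≤ C := by
  refine opNorm_le_bound _ hC fun u => Lp.norm_le_mul_norm_of_ae_le_mul ?_
  filter_upwards [coeFn_mulOp hm u, h] with x hx hmx
  rw [hx, norm_mul]
  gcongr

theorem mulOp_sub (hm : MemLp m ∞ μ) (hn : MemLp n ∞ μ) :
    mulOp (hm.sub hn) = mulOp hm - mulOp hn :=
  (congrArg _ (hm.toLp_sub hn)).trans (map_sub _ _ _)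

theorem adjoint_mulOp_star (hm : MemLp m ∞ μ) : (mulOp hm.star)† = mulOp hm := by
  refine Eq.symm <| (eq_adjoint_iff _ _).2 fun u v => ?_
  rw [L2.inner_def, L2.inner_def]
  refine integral_congr_ae ?_
  filter_upwards [coeFn_mulOp hm u, coeFn_mulOp hm.star v] with x hu hv
  simp only [hu, hv, RCLike.inner_apply, Pi.star_apply, RCLike.star_def, map_mul]
  ring

end MulOp

section IsMulComp

variable {α F : Type*} [MeasurableSpace α] {μ : Measure α}
  [NormedAddCommGroup F] [NormedSpace ℂ F] {V W : α → ℝ}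
  {A S T : F →L[ℂ] Lp ℂ 2 μ}

/-- `IsMulComp V A T` says that the operator product `V A`, in which `V` acts by multiplication,
is defined on the whole space and equal to the bounded operator `T`. -/
def IsMulComp (V : α → ℝ) (A T : F →L[ℂ] Lp ℂ 2 μ) : Prop :=
  ∀ u, T u =ᵐ[μ] fun x => (V x : ℂ) * A u x

theorem IsMulComp.add (hS : IsMulComp V A S) (hT : IsMulComp W A T) :
    IsMulComp (V + W) A (S + T) := fun u => by
  filter_upwards [hS u, hT u, Lp.coeFn_add (S u) (T u)] with x hSx hTx hx
  rw [add_apply, hx, Pi.add_apply, hSx, hTx, Pi.add_apply, Complex.ofReal_add, add_mul]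

theorem isMulComp_mulOp_comp (hV : MemLp V ∞ μ) (A : F →L[ℂ] Lp ℂ 2 μ) :
    IsMulComp V A (mulOp hV.ofReal ∘L A) := fun u => coeFn_mulOp _ (A u)

theorem exists_isMulComp_of_lintegral_le (hV : AEStronglyMeasurable V μ) {C : ℝ≥0∞} (hC : C ≠ ∞)
    (h : ∀ u, ∫⁻ x, ‖V x‖ₑ ^ 2 * ‖A u x‖ₑ ^ 2 ∂μ ≤ C * ‖u‖ₑ ^ 2) : ∃ T, IsMulComp V A T := by
  have hnorm (u : F) : eLpNorm (fun x => (V x : ℂ) * A u x) 2 μ ^ 2 ≤ C * ‖u‖ₑ ^ 2 := by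
    refine le_of_eq_of_le ?_ (h u)
    simp only [eLpNorm_two_sq, enorm_mul, mul_pow]
    simp only [enorm_eq_nnnorm, Complex.nnnorm_real]
  have hmem (u : F) : MemLp (fun x => (V x : ℂ) * A u x) 2 μ :=
    ⟨(Complex.continuous_ofReal.comp_aestronglyMeasurable hV).mul (Lp.aestronglyMeasurable _), by
      simpa using (hnorm u).trans_lt (ENNReal.mul_lt_top hC.lt_top (by simp))⟩
  let T : F →ₗ[ℂ] Lp ℂ 2 μ :=
    { toFun u := (hmem u).toLp
      map_add' u v := by
        rw [← MemLp.toLp_add]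
        refine MemLp.toLp_congr _ _ ?_
        filter_upwards [Lp.coeFn_add (A u) (A v)] with x hx
        simp only [map_add, hx, Pi.add_apply, mul_add]
      map_smul' a u := by
        rw [RingHom.id_apply, ← MemLp.toLp_const_smul]
        refine MemLp.toLp_congr _ _ ?_
        filter_upwards [Lp.coeFn_smul a (A u)] with x hx
        simp only [map_smul, hx, Pi.smul_apply, smul_eq_mul, mul_left_comm] }
  refine ⟨T.mkContinuous √C.toReal fun u => ?_, fun u => (hmem u).coeFn_toLp⟩
  have hT : ‖T u‖ₑ ^ 2 ≤ C * ‖u‖ₑ ^ 2 :=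
    (congrArg (· ^ 2) (Lp.enorm_toLp (hmem u))).trans_le (hnorm u)
  rw [← sq_le_sq₀ (norm_nonneg _) (by positivity), mul_pow, Real.sq_sqrt ENNReal.toReal_nonneg]
  simpa using ENNReal.toReal_mono (ENNReal.mul_ne_top hC (by simp)) hT

end IsMulComp

section Adjoint

variable {α F G : Type*} [MeasurableSpace α] {μ : Measure α}
  [NormedAddCommGroup F] [InnerProductSpace ℂ F] [CompleteSpace F]
  [NormedAddCommGroup G] [NormedSpace ℂ G]

theorem IsMulComp.adjoint_comp_eq {V : α → ℝ} {A S : F →L[ℂ] Lp ℂ 2 μ} {B T : G →L[ℂ] Lp ℂ 2 μ}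
    (hS : IsMulComp V A S) (hT : IsMulComp V B T) : A† ∘L T = S† ∘L B := by
  refine ContinuousLinearMap.ext fun u => ext_inner_right ℂ fun v => ?_
  rw [comp_apply, comp_apply, adjoint_inner_left, adjoint_inner_left, L2.inner_def, L2.inner_def]
  refine integral_congr_ae ?_
  filter_upwards [hS v, hT u] with x hSx hTx
  simp only [hSx, hTx, RCLike.inner_apply, map_mul, Complex.conj_ofReal]
  ring

end Adjoint

section KernelIntegral

variable {α H : Type*} [MeasurableSpace α] {μ : Measure α} [NormedAddCommGroup H]
  [NormedSpace ℂ H] [CompleteSpace H]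

/-- The integral operator `h ↦ ∫ h(x) k(x) dμ(x)` from `L²(μ)` to `H` with the square integrable
`H`-valued kernel `k`. -/
def kernelIntegral (k : Lp H 2 μ) : Lp ℂ 2 μ →L[ℂ] H :=
  ((lsmul ℂ ℂ : ℂ →L[ℂ] H →L[ℂ] H).lpPairing μ 2 2).flip k

theorem kernelIntegral_apply (k : Lp H 2 μ) (h : Lp ℂ 2 μ) :
    kernelIntegral k h = ∫ x, h x • k x ∂μ := by
  rw [kernelIntegral, flip_apply, lpPairing_eq_integral]
  rfl

theorem isCompactOperator_kernelIntegral (k : Lp H 2 μ) : IsCompactOperator (kernelIntegral k) := by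
  induction k using Lp.induction (ENNReal.ofNat_ne_top : (2 : ℝ≥0∞) ≠ ∞) with
  | @indicatorConst c s hs hμs =>
    have hrank : kernelIntegral (Lp.simpleFunc.indicatorConst 2 hs hμs.ne c : Lp H 2 μ) =
        toSpanSingleton ℂ c ∘L kernelIntegral (indicatorConstLp 2 hs hμs.ne (1 : ℂ)) := by
      refine ContinuousLinearMap.ext fun h => ?_
      rw [ContinuousLinearMap.comp_apply, toSpanSingleton_apply, kernelIntegral_apply,
        kernelIntegral_apply, ← integral_smul_const, Lp.simpleFunc.coe_indicatorConst]
      refine integral_congr_ae ?_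
      filter_upwards [indicatorConstLp_coeFn (p := 2) (hs := hs) (hμs := hμs.ne) (c := c),
        indicatorConstLp_coeFn (p := 2) (hs := hs) (hμs := hμs.ne) (c := (1 : ℂ))] with x hc h1
      by_cases hx : x ∈ s <;> simp [hc, h1, hx]
    rw [hrank]
    exact (isCompactOperator_of_locallyCompactSpace_rng (toSpanSingleton ℂ c)).comp_clm _
  | add hf hg _ ihf ihg => rw [kernelIntegral, map_add]; exact ihf.add ihg
  | isClosed =>
    exact isClosed_setOfPred_isCompactOperator.preimage
      ((lsmul ℂ ℂ : ℂ →L[ℂ] H →L[ℂ] H).lpPairing μ 2 2).flip.continuous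

end KernelIntegral

section AdjointKernelIntegral

variable {α H : Type*} [MeasurableSpace α] {μ : Measure α} [NormedAddCommGroup H]
  [InnerProductSpace ℂ H] [CompleteSpace H]

theorem coeFn_adjoint_kernelIntegral (k : Lp H 2 μ) (v : H) :
    ((kernelIntegral k)†) v =ᵐ[μ] fun x => inner ℂ (k x) v := by
  have hmem : MemLp (fun x => inner ℂ (k x) v) 2 μ := (Lp.memLp k).inner_const v
  suffices h : ((kernelIntegral k)†) v = hmem.toLp by rw [h]; exact hmem.coeFn_toLp
  refine ext_inner_left ℂ fun h => ?_
  have hint : Integrable (fun x => h x • k x) μ :=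
    memLp_one_iff_integrable.1 ((Lp.memLp k).smul (Lp.memLp h))
  rw [adjoint_inner_right, kernelIntegral_apply, ← inner_conj_symm, ← integral_inner hint,
    ← integral_conj, L2.inner_def]
  refine integral_congr_ae ?_
  filter_upwards [hmem.coeFn_toLp] with x hx
  rw [hx, inner_conj_symm, inner_smul_left, RCLike.inner_apply, mul_comm]

end AdjointKernelIntegral

theorem continuous_of_continuous_inner_of_norm {𝕜 X H : Type*} [RCLike 𝕜] [TopologicalSpace X]
    [NormedAddCommGroup H] [InnerProductSpace 𝕜 H] {f : X → H}
    (hinner : ∀ v, Continuous fun x => inner 𝕜 (f x) v) (hnorm : Continuous fun x => ‖f x‖) :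
    Continuous f := by
  refine continuous_iff_continuousAt.2 fun y => tendsto_iff_norm_sub_tendsto_zero.2 ?_
  have hsq : Continuous fun x => ‖f x - f y‖ ^ 2 := by
    simp only [@norm_sub_sq 𝕜]
    have := RCLike.continuous_re.comp (hinner (f y))
    fun_prop
  simpa [Real.sqrt_sq] using (hsq.tendsto y).sqrt

section Fourier

variable {E : Type*} [NormedAddCommGroup E] [InnerProductSpace ℝ E] [FiniteDimensional ℝ E]
  [MeasurableSpace E] [BorelSpace E]

section FourierInv

variable {F : Type*} [NormedAddCommGroup F] [NormedSpace ℂ F]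

theorem continuous_fourierInv_of_integrable {f : E → F} (hf : Integrable f) :
    Continuous (𝓕⁻ f) := by
  rw [← Real.Lp.fourierTransformInv_toLp (memLp_one_iff_integrable.2 hf)]
  exact BoundedContinuousFunction.continuous _

theorem enorm_fourierInv_le (f : E → F) (x : E) : ‖𝓕⁻ f x‖ₑ ≤ ∫⁻ ξ, ‖f ξ‖ₑ := by
  rw [Real.fourierInv_eq]
  refine (enorm_integral_le_lintegral_enorm _).trans_eq ?_
  simp only [← ofReal_norm, Circle.norm_smul]

theorem integral_smul_fourierInv_eq [CompleteSpace F] {g : E → ℂ} {f : E → F} (hg : Integrable g)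
    (hf : Integrable f) : ∫ x, g x • 𝓕⁻ f x = ∫ ξ, 𝓕⁻ g ξ • f ξ := by
  have hcont : Continuous fun p : E × E => (-innerₗ E) p.1 p.2 :=
    (continuous_fst.inner continuous_snd).neg
  have hflip : (-innerₗ E).flip = -innerₗ E := by
    ext x y
    exact congrArg Neg.neg (real_inner_comm x y)
  have h := VectorFourier.integral_fourierIntegral_smul_eq_flip (μ := volume) (ν := volume)
    (L := -innerₗ E) Real.continuous_fourierChar hcont hg hf
  rw [hflip] at h
  exact h.symm

end FourierInv

theorem coeFn_fourierInv_ae_eq {F : Type*} [NormedAddCommGroup F] [InnerProductSpace ℂ F]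
    [CompleteSpace F] (f : Lp (α := E) F 2) (hf : Integrable f) :
    (𝓕⁻ f : Lp (α := E) F 2) =ᵐ[volume] 𝓕⁻ (f : E → F) := by
  refine ae_eq_of_integral_contDiff_smul_eq ((Lp.memLp (𝓕⁻ f)).locallyIntegrable one_le_two)
    (continuous_fourierInv_of_integrable hf).locallyIntegrable fun g hg hgc => ?_
  have hgc' : HasCompactSupport (Complex.ofRealCLM ∘ g) := hgc.comp_left rfl
  have hg' : ContDiff ℝ (⊤ : ℕ∞) (Complex.ofRealCLM ∘ g) := by fun_prop
  let φ : SchwartzMap E ℂ := hgc'.toSchwartzMap hg'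
  have hdistr := DFunLike.congr_fun (Lp.fourierInv_toTemperedDistribution_eq f) φ
  rw [TemperedDistribution.fourierInv_apply, Lp.toTemperedDistribution_apply,
    Lp.toTemperedDistribution_apply] at hdistr
  calc ∫ x, g x • (𝓕⁻ f : Lp (α := E) F 2 volume) x
      = ∫ x, φ x • (𝓕⁻ f : Lp (α := E) F 2 volume) x := rfl
    _ = ∫ ξ, 𝓕⁻ (φ : E → ℂ) ξ • f ξ := by rw [← hdistr, SchwartzMap.fourierInv_coe]
    _ = ∫ x, φ x • 𝓕⁻ (f : E → F) x := (integral_smul_fourierInv_eq φ.integrable hf).symm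
    _ = ∫ x, g x • 𝓕⁻ (f : E → F) x := rfl

section Modulate

/-- The product of the square integrable function `c` and the character
`ξ ↦ exp (-2 π i ⟨ξ, x⟩)`. -/
def modulate (c : Lp (α := E) ℂ 2) (x : E) : Lp (α := E) ℂ 2 :=
  MemLp.toLp (fun ξ => Real.fourierChar (-inner ℝ ξ x) • c ξ) <| by
    have hchar : Continuous fun ξ : E => Real.fourierChar (-inner ℝ ξ x) := by fun_prop
    exact (Lp.memLp c).of_le (hchar.aestronglyMeasurable.smul (Lp.aestronglyMeasurable c))
      (ae_of_all _ fun ξ => (Circle.norm_smul _ _).le)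

theorem coeFn_modulate (c : Lp (α := E) ℂ 2) (x : E) :
    modulate c x =ᵐ[volume] fun ξ => Real.fourierChar (-inner ℝ ξ x) • c ξ :=
  MemLp.coeFn_toLp _

theorem norm_modulate (c : Lp (α := E) ℂ 2) (x : E) : ‖modulate c x‖ = ‖c‖ := by
  rw [modulate, Lp.norm_toLp, Lp.norm_def]
  exact congrArg _ (eLpNorm_congr_norm_ae (ae_of_all _ fun ξ => Circle.norm_smul _ _))

theorem inner_modulate (c v : Lp (α := E) ℂ 2) (x : E) :
    inner ℂ (modulate c x) v = 𝓕⁻ (fun ξ => star (c ξ) * v ξ) x := by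
  rw [L2.inner_def, Real.fourierInv_eq]
  refine integral_congr_ae ?_
  filter_upwards [coeFn_modulate c x] with ξ hξ
  simp only [hξ, RCLike.inner_apply, Circle.smul_def, smul_eq_mul, map_mul,
    AddChar.map_neg_eq_inv, ← Circle.coe_inv_eq_conj, inv_inv, RCLike.star_def]
  ring

theorem continuous_modulate (c : Lp (α := E) ℂ 2) : Continuous (modulate c) := by
  refine continuous_of_continuous_inner_of_norm (𝕜 := ℂ) (fun v => ?_) ?_
  · simp only [inner_modulate]
    exact continuous_fourierInv_of_integrable ((Lp.memLp c).star.integrable_mul (Lp.memLp v))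
  · simp only [norm_modulate, continuous_const]

end Modulate

section FourierMultiplier

variable {m n : E → ℂ}

/-- The Fourier multiplier `m(D)` on `L²` with the essentially bounded symbol `m`. -/
def fourierMultiplier (hm : MemLp m ∞) : Lp (α := E) ℂ 2 →L[ℂ] Lp (α := E) ℂ 2 :=
  ((Lp.fourierTransformₗᵢ E ℂ).symm.toContinuousLinearEquiv : Lp (α := E) ℂ 2 →L[ℂ] _) ∘L
    mulOp hm ∘L
    ((Lp.fourierTransformₗᵢ E ℂ).toContinuousLinearEquiv : _ →L[ℂ] Lp (α := E) ℂ 2)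

theorem fourierMultiplier_apply (hm : MemLp m ∞) (u : Lp (α := E) ℂ 2) :
    fourierMultiplier hm u = 𝓕⁻ (mulOp hm (𝓕 u)) := rfl

theorem norm_fourierMultiplier_le (hm : MemLp m ∞) {C : ℝ} (hC : 0 ≤ C) (h : ∀ᵐ ξ, ‖m ξ‖ ≤ C) :
    ‖fourierMultiplier hm‖ ≤ C := by
  refine opNorm_le_bound _ hC fun u => ?_
  calc ‖fourierMultiplier hm u‖ = ‖mulOp hm (𝓕 u)‖ :=
        (Lp.fourierTransformₗᵢ E ℂ).symm.norm_map _
    _ ≤ C * ‖𝓕 u‖ := (mulOp hm).le_of_opNorm_le (norm_mulOp_le hm hC h) _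
    _ = C * ‖u‖ := by rw [Lp.norm_fourier_eq]

theorem fourierMultiplier_sub (hm : MemLp m ∞) (hn : MemLp n ∞) :
    fourierMultiplier (hm.sub hn) = fourierMultiplier hm - fourierMultiplier hn := by
  rw [fourierMultiplier, mulOp_sub hm hn, ContinuousLinearMap.sub_comp,
    ContinuousLinearMap.comp_sub]
  rfl

theorem adjoint_fourierMultiplier_star (hm : MemLp m ∞) :
    (fourierMultiplier hm.star)† = fourierMultiplier hm := by
  rw [fourierMultiplier, adjoint_comp, adjoint_comp, adjoint_mulOp_star hm,
    LinearIsometryEquiv.adjoint_eq_symm, LinearIsometryEquiv.adjoint_eq_symm]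
  rfl

theorem exists_isMulComp_fourierMultiplier_of_memLp_two {V : E → ℝ} (hV : MemLp V 2)
    (hm : MemLp m ∞) (hm₂ : MemLp m 2) :
    ∃ A, IsMulComp V (fourierMultiplier hm) A ∧ IsCompactOperator (A†) := by
  -- On the Fourier side `V m(D)` has the kernel `V(x) m(ξ) exp(2πi⟨ξ, x⟩)`; viewed as a function
  -- of `x` with values in `L²(dξ)`, it is square integrable.
  let c : Lp (α := E) ℂ 2 volume := hm₂.star.toLp
  have hk : MemLp (fun x => (V x : ℂ) • modulate c x) 2 := by
    refine (hV.norm.const_mul ‖c‖).of_le ?_ (ae_of_all _ fun x => ?_)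
    · exact (Complex.continuous_ofReal.comp_aestronglyMeasurable hV.1).smul
        (continuous_modulate c).aestronglyMeasurable
    · rw [norm_smul, norm_modulate, mul_comm]
      simp
  let U : Lp (α := E) ℂ 2 volume →L[ℂ] Lp (α := E) ℂ 2 volume :=
    (Lp.fourierTransformₗᵢ E ℂ).toContinuousLinearEquiv
  refine ⟨(kernelIntegral hk.toLp)† ∘L U, fun u => ?_, ?_⟩
  · have hmul : mulOp hm (𝓕 u) =ᵐ[volume]
        fun ξ => star (c ξ) * (𝓕 u : Lp (α := E) ℂ 2 volume) ξ := by
      filter_upwards [coeFn_mulOp hm (𝓕 u), hm₂.star.coeFn_toLp] with ξ hξ hc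
      rw [hξ, hc, Pi.star_apply, star_star]
    have hint : Integrable (mulOp hm (𝓕 u)) :=
      ((Lp.memLp c).star.integrable_mul (Lp.memLp (𝓕 u))).congr hmul.symm
    filter_upwards [coeFn_adjoint_kernelIntegral hk.toLp (𝓕 u), hk.coeFn_toLp,
      coeFn_fourierInv_ae_eq _ hint] with x hadj hkx hinv
    rw [fourierMultiplier_apply, hinv, Real.fourierInv_congr_ae hmul, ← inner_modulate]
    refine hadj.trans ?_
    rw [hkx, inner_smul_left, Complex.conj_ofReal]
  · rw [adjoint_comp, adjoint_adjoint]
    exact (isCompactOperator_kernelIntegral hk.toLp).clm_comp (U†)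

theorem IsMulComp.isCompactOperator_fourierMultiplier_comp_of_memLp_two {F : Type*}
    [NormedAddCommGroup F] [NormedSpace ℂ F] {V : E → ℝ} {B T : F →L[ℂ] Lp (α := E) ℂ 2 volume}
    (hT : IsMulComp V B T) (hV : MemLp V 2) (hm : MemLp m ∞) (hm₂ : MemLp m 2) :
    IsCompactOperator (fourierMultiplier hm ∘L T) := by
  obtain ⟨A, hA, hAc⟩ := exists_isMulComp_fourierMultiplier_of_memLp_two hV hm.star hm₂.star
  rw [← adjoint_fourierMultiplier_star hm, hA.adjoint_comp_eq hT]
  exact hAc.comp_clm B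

theorem IsMulComp.isCompactOperator_fourierMultiplier_comp {F : Type*}
    [NormedAddCommGroup F] [NormedSpace ℂ F] {V : E → ℝ} {B T : F →L[ℂ] Lp (α := E) ℂ 2 volume}
    (hT : IsMulComp V B T) (hV : MemLp V 2) (hm : MemLp m ∞)
    (hm₀ : Tendsto m (cocompact E) (𝓝 0)) :
    IsCompactOperator (fourierMultiplier hm ∘L T) := by
  refine isCompactOperator_of_forall_exists_norm_sub_le fun ε hε => ?_
  obtain ⟨δ, hδ, hδε⟩ := exists_pos_mul_lt hε ‖T‖
  obtain ⟨R, hR⟩ : ∃ R : ℝ, ∀ ξ, R ≤ ‖ξ‖ → ‖m ξ‖ < δ := by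
    rw [← Metric.cobounded_eq_cocompact] at hm₀
    simpa using hasBasis_cobounded_norm.eventually_iff.1 (hm₀.norm.eventually_lt_const (by simpa))
  have hball : MeasurableSet (Metric.ball (0 : E) R) := Metric.isOpen_ball.measurableSet
  let n : E → ℂ := (Metric.ball 0 R).indicator m
  have hn : MemLp n ∞ := hm.indicator hball
  have hn₂ : MemLp n 2 := by
    have : IsFiniteMeasure (volume.restrict (Metric.ball (0 : E) R)) :=
      ⟨by simpa using measure_ball_lt_top⟩
    exact (memLp_indicator_iff_restrict hball).2 ((hm.restrict _).mono_exponent le_top)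
  have hmn (ξ : E) : ‖(m - n) ξ‖ ≤ δ := by
    by_cases hξ : ξ ∈ Metric.ball 0 R
    · simpa [n, Set.indicator_of_mem hξ] using hδ.le
    · simpa [n, Set.indicator_of_notMem hξ] using (hR ξ (by simpa using hξ)).le
  refine ⟨_, hT.isCompactOperator_fourierMultiplier_comp_of_memLp_two hV hn hn₂, ?_⟩
  calc ‖fourierMultiplier hm ∘L T - fourierMultiplier hn ∘L T‖
      = ‖fourierMultiplier (hm.sub hn) ∘L T‖ := by
        rw [fourierMultiplier_sub, ContinuousLinearMap.sub_comp]
    _ ≤ δ * ‖T‖ := (opNorm_comp_le _ _).trans <| by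
        gcongr
        exact norm_fourierMultiplier_le _ hδ.le (ae_of_all _ hmn)
    _ ≤ ε := (mul_comm _ _).trans_le hδε.le

end FourierMultiplier

end Fourier

section WeakLp

theorem lintegral_Ioi_rpow {a c : ℝ} (ha : a < -1) (hc : 0 < c) :
    ∫⁻ t in Set.Ioi c, ENNReal.ofReal (t ^ a) = ENNReal.ofReal (c ^ (a + 1) / -(a + 1)) := by
  rw [← ofReal_integral_eq_lintegral_ofReal (integrableOn_Ioi_rpow_of_lt ha hc)
    ((ae_restrict_iff' measurableSet_Ioi).2 <| ae_of_all _ fun t ht =>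
      Real.rpow_nonneg (hc.trans ht).le a), integral_Ioi_rpow_of_lt ha hc, div_neg, neg_div]

theorem lintegral_Ioc_rpow {a c : ℝ} (ha : -1 < a) (hc : 0 ≤ c) :
    ∫⁻ t in Set.Ioc 0 c, ENNReal.ofReal (t ^ a) = ENNReal.ofReal (c ^ (a + 1) / (a + 1)) := by
  have hint : IntegrableOn (fun t : ℝ => t ^ a) (Set.Ioc 0 c) :=
    (intervalIntegrable_iff_integrableOn_Ioc_of_le hc).1
      (intervalIntegral.intervalIntegrable_rpow' ha)
  rw [← ofReal_integral_eq_lintegral_ofReal hint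
    ((ae_restrict_iff' measurableSet_Ioc).2 <| ae_of_all _ fun t ht => Real.rpow_nonneg ht.1.le a),
    ← intervalIntegral.integral_of_le hc, integral_rpow (Or.inl ha),
    Real.zero_rpow (by linarith), sub_zero]

variable {α : Type*} [MeasurableSpace α] {μ : Measure α}

theorem sq_lintegral_mul_le {f g : α → ℝ≥0∞} (hf : AEMeasurable f μ) (hg : AEMeasurable g μ) :
    (∫⁻ x, f x * g x ∂μ) ^ 2 ≤ (∫⁻ x, f x ^ 2 ∂μ) * ∫⁻ x, g x ^ 2 ∂μ := by
  have h := pow_le_pow_left₀ zero_le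
    (ENNReal.lintegral_mul_le_Lp_mul_Lq μ Real.HolderConjugate.two_two hf hg) 2
  have hsqrt (y : ℝ≥0∞) : (y ^ (1 / 2 : ℝ)) ^ 2 = y := by
    rw [← ENNReal.rpow_natCast, ← ENNReal.rpow_mul]
    norm_num
  rw [mul_pow, hsqrt, hsqrt] at h
  simpa only [Pi.mul_apply, ENNReal.rpow_two] using h

theorem lintegral_mul_setLIntegral_swap {β : Type*} [MeasurableSpace β] {ν : Measure β}
    [SFinite μ] [SFinite ν] {S : Set (α × β)} (hS : MeasurableSet S) {f : α → ℝ≥0∞} {g : β → ℝ≥0∞}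
    (hf : AEMeasurable f μ) (hg : AEMeasurable g ν) :
    ∫⁻ x, f x * ∫⁻ y in {y | (x, y) ∈ S}, g y ∂ν ∂μ =
      ∫⁻ y, g y * ∫⁻ x in {x | (x, y) ∈ S}, f x ∂μ ∂ν := by
  have hfg : AEMeasurable (S.indicator fun q => f q.1 * g q.2) (μ.prod ν) :=
    (hf.comp_fst.mul hg.comp_snd).indicator hS
  have hx (x : α) : f x * ∫⁻ y in {y | (x, y) ∈ S}, g y ∂ν =
      ∫⁻ y, S.indicator (fun q => f q.1 * g q.2) (x, y) ∂ν := by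
    rw [← lintegral_const_mul'' _ hg.restrict]
    exact (lintegral_indicator (hS.preimage measurable_prodMk_left) _).symm
  have hy (y : β) : g y * ∫⁻ x in {x | (x, y) ∈ S}, f x ∂μ =
      ∫⁻ x, S.indicator (fun q => f q.1 * g q.2) (x, y) ∂μ := by
    rw [mul_comm, ← lintegral_mul_const'' _ hf.restrict]
    exact (lintegral_indicator (hS.preimage measurable_prodMk_right) _).symm
  simp only [hx, hy]
  exact lintegral_lintegral_swap hfg

/-- The weak type bound `μ {‖f‖ > t} ≤ K t⁻ᵖ` for all `t > 0`: for `K < ∞` it expresses that the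
function `f` is in the Lorentz space `L^{p,∞}(μ)`. -/
def HasWeakLpBound {F : Type*} [Norm F] (f : α → F) (p : ℝ) (K : ℝ≥0∞) (μ : Measure α) : Prop :=
  ∀ t : ℝ, 0 < t → μ {x | t < ‖f x‖} ≤ K * ENNReal.ofReal (t ^ (-p))

variable {F : Type*} [NormedAddCommGroup F] {f g : α → F} {p : ℝ} {K : ℝ≥0∞}

theorem HasWeakLpBound.congr_ae (hf : HasWeakLpBound f p K μ) (hfg : f =ᵐ[μ] g) :
    HasWeakLpBound g p K μ := fun t ht => by
  refine (measure_congr ?_).trans_le (hf t ht)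
  filter_upwards [hfg] with x hx
  exact congrArg (fun y : F => t < ‖y‖) hx.symm

theorem HasWeakLpBound.setLIntegral_rpow_le (hf : HasWeakLpBound f p K μ)
    (hfm : AEStronglyMeasurable f μ) {b s : ℝ} (hb : 0 < b) (hbp : b < p) (hs : 0 < s) :
    ∫⁻ x in {x | s < ‖f x‖}, ENNReal.ofReal (‖f x‖ ^ b) ∂μ ≤
      K * ENNReal.ofReal (p / (p - b) * s ^ (b - p)) := by
  have hsmall : ∀ t ∈ Set.Ioc 0 s, μ.restrict {x | s < ‖f x‖} {x | t < ‖f x‖} *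
      ENNReal.ofReal (t ^ (b - 1)) ≤
      K * ENNReal.ofReal (s ^ (-p)) * ENNReal.ofReal (t ^ (b - 1)) := fun t _ => by
    gcongr
    exact (measure_mono (Set.subset_univ _)).trans
      ((Measure.restrict_apply_univ _).trans_le (hf s hs))
  have hlarge : ∀ t ∈ Set.Ioi s, μ.restrict {x | s < ‖f x‖} {x | t < ‖f x‖} *
      ENNReal.ofReal (t ^ (b - 1)) ≤ K * ENNReal.ofReal (t ^ (b - 1 - p)) := fun t ht => by
    have ht0 : 0 < t := hs.trans ht
    rw [sub_eq_neg_add (b - 1) p, Real.rpow_add ht0, ENNReal.ofReal_mul (by positivity),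
      ← mul_assoc]
    gcongr
    exact (Measure.restrict_le_self _).trans (hf t ht0)
  calc _ = ENNReal.ofReal b * ((∫⁻ t in Set.Ioc 0 s, μ.restrict {x | s < ‖f x‖} {x | t < ‖f x‖} *
          ENNReal.ofReal (t ^ (b - 1))) + ∫⁻ t in Set.Ioi s,
          μ.restrict {x | s < ‖f x‖} {x | t < ‖f x‖} * ENNReal.ofReal (t ^ (b - 1))) := by
        rw [lintegral_rpow_eq_lintegral_meas_lt_mul _ (ae_of_all _ fun x => norm_nonneg _)
          hfm.norm.aemeasurable.restrict hb, ← Set.Ioc_union_Ioi_eq_Ioi hs.le,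
          lintegral_union measurableSet_Ioi (Set.Ioc_disjoint_Ioi le_rfl)]
    _ ≤ ENNReal.ofReal b * (K * ENNReal.ofReal (s ^ (-p)) * ENNReal.ofReal (s ^ b / b) +
          K * ENNReal.ofReal (s ^ (b - p) / (p - b))) := by
        gcongr
        · refine (setLIntegral_mono' measurableSet_Ioc hsmall).trans_eq ?_
          rw [lintegral_const_mul _ (by fun_prop), lintegral_Ioc_rpow (by linarith) hs.le,
            sub_add_cancel]
        · refine (setLIntegral_mono' measurableSet_Ioi hlarge).trans_eq ?_
          rw [lintegral_const_mul _ (by fun_prop), lintegral_Ioi_rpow (by linarith) hs]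
          ring_nf
    _ = K * ENNReal.ofReal (p / (p - b) * s ^ (b - p)) := by
        have hpb : 0 < p - b := sub_pos.2 hbp
        have hfactor : b * (s ^ (-p) * (s ^ b / b) + s ^ (b - p) / (p - b)) =
            p / (p - b) * s ^ (b - p) := by
          rw [sub_eq_neg_add b p, Real.rpow_add hs]
          field_simp
          ring
        rw [mul_assoc, ← ENNReal.ofReal_mul (by positivity), ← mul_add,
          ← ENNReal.ofReal_add (by positivity) (by positivity), mul_left_comm,
          ← ENNReal.ofReal_mul hb.le, hfactor]

theorem HasWeakLpBound.sq_setLIntegral_mul_le (hf : HasWeakLpBound f p K μ)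
    (hfm : AEStronglyMeasurable f μ) {G : α → ℝ≥0∞} (hG : AEMeasurable G μ) {b s : ℝ} (hb : 0 < b)
    (hbp : b < p) (hs : 0 < s) :
    (∫⁻ x in {x | s < ‖f x‖}, ‖f x‖ₑ * G x ∂μ) ^ 2 ≤
      K * ENNReal.ofReal (p / (p - b) * s ^ (b - p)) *
        ∫⁻ x in {x | s < ‖f x‖}, ENNReal.ofReal (‖f x‖ ^ (2 - b)) * G x ^ 2 ∂μ := by
  have hS : NullMeasurableSet {x | s < ‖f x‖} μ :=
    nullMeasurableSet_lt aemeasurable_const hfm.norm.aemeasurable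
  have hpow (c : ℝ) : AEMeasurable (fun x => ENNReal.ofReal (‖f x‖ ^ c)) μ :=
    (hfm.norm.aemeasurable.pow_const c).ennreal_ofReal
  have hsplit : ∀ x ∈ {x | s < ‖f x‖}, ‖f x‖ₑ * G x =
      ENNReal.ofReal (‖f x‖ ^ (b / 2)) * (ENNReal.ofReal (‖f x‖ ^ (1 - b / 2)) * G x) :=
    fun x hx => by
      rw [← mul_assoc, ← ENNReal.ofReal_mul (by positivity), ← Real.rpow_add (hs.trans hx),
        add_sub_cancel, Real.rpow_one, ofReal_norm]
  have hsq (x : α) (c : ℝ) : ENNReal.ofReal (‖f x‖ ^ c) ^ 2 = ENNReal.ofReal (‖f x‖ ^ (2 * c)) := by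
    rw [← ENNReal.ofReal_pow (by positivity), mul_comm, Real.rpow_mul (norm_nonneg _)]
    norm_cast
  rw [lintegral_congr_ae ((ae_restrict_iff'₀ hS).2 (ae_of_all _ hsplit))]
  refine (sq_lintegral_mul_le (hpow _).restrict ((hpow _).mul hG).restrict).trans ?_
  simp only [Pi.mul_apply, mul_pow, hsq, mul_sub, mul_one, mul_div_cancel₀ b (two_ne_zero' ℝ)]
  gcongr
  exact hf.setLIntegral_rpow_le hfm hb hbp hs

theorem lintegral_Ioi_rpow_mul_setLIntegral_lt_le [SFinite μ] {g : α → ℝ} (hg : Measurable g)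
    (hg0 : ∀ x, 0 ≤ g x) {G : α → ℝ≥0∞} (hG : AEMeasurable G μ) {b : ℝ} (hb : 2 < b) :
    ∫⁻ t in Set.Ioi 0, ENNReal.ofReal (t ^ (1 - b)) *
        ∫⁻ x in {x | t⁻¹ < g x}, ENNReal.ofReal (g x ^ (2 - b)) * G x ∂μ ≤
      ENNReal.ofReal (1 / (b - 2)) * ∫⁻ x, G x ∂μ := by
  have hS : MeasurableSet {q : ℝ × α | q.1⁻¹ < g q.2} :=
    measurableSet_lt (by fun_prop) (by fun_prop)
  have hpow : AEMeasurable (fun x => ENNReal.ofReal (g x ^ (2 - b))) μ := by fun_prop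
  refine (lintegral_mul_setLIntegral_swap hS (by fun_prop) (hpow.mul hG)).trans_le ?_
  rw [← lintegral_const_mul'' _ hG]
  refine lintegral_mono fun x => ?_
  simp only [Set.mem_ofPred_eq, Pi.mul_apply]
  rw [mul_right_comm]
  gcongr
  rw [Measure.restrict_restrict (measurableSet_lt (by fun_prop) (by fun_prop))]
  obtain hx | hx := (hg0 x).eq_or_lt
  · have hempty : {t : ℝ | t⁻¹ < g x} ∩ Set.Ioi 0 = ∅ := by
      ext t
      simpa [← hx] using fun ht : t < 0 => ht.le
    simp [hempty]
  · have hIoi : {t : ℝ | t⁻¹ < g x} ∩ Set.Ioi 0 = Set.Ioi (g x)⁻¹ := by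
      ext t
      exact ⟨fun ht => Set.mem_Ioi.2 (inv_lt_of_inv_lt₀ ht.2 ht.1), fun ht =>
        ⟨inv_lt_of_inv_lt₀ hx (Set.mem_Ioi.1 ht), (inv_pos.2 hx).trans ht⟩⟩
    rw [hIoi, lintegral_Ioi_rpow (by linarith) (inv_pos.2 hx), ← ENNReal.ofReal_mul (by positivity),
      Real.inv_rpow hx.le, ← Real.rpow_neg hx.le, ← mul_div_assoc, ← Real.rpow_add hx]
    ring_nf
    simp

theorem lintegral_enorm_sq_mul_eq_lintegral_setLIntegral_lt [SFinite μ]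
    (hfm : AEStronglyMeasurable f μ) {G : α → ℝ≥0∞} (hG : AEMeasurable G μ) :
    ∫⁻ x, ‖f x‖ₑ ^ 2 * G x ∂μ =
      2 * ∫⁻ t in Set.Ioi 0, ENNReal.ofReal t * ∫⁻ x in {x | t < ‖f x‖}, G x ∂μ := by
  calc _ = ∫⁻ x, ENNReal.ofReal (‖f x‖ ^ (2 : ℝ)) ∂μ.withDensity G := by
        rw [lintegral_withDensity_eq_lintegral_mul₀ hG
          (hfm.norm.aemeasurable.pow_const _).ennreal_ofReal]
        refine lintegral_congr fun x => ?_
        rw [Pi.mul_apply, mul_comm, Real.rpow_two, ENNReal.ofReal_pow (norm_nonneg _), ofReal_norm]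
    _ = _ := by
        rw [lintegral_rpow_eq_lintegral_meas_lt_mul _ (ae_of_all _ fun x => norm_nonneg _)
          (hfm.norm.aemeasurable.mono_ac (withDensity_absolutelyContinuous _ _)) two_pos,
          ENNReal.ofReal_ofNat]
        norm_num [withDensity_apply', mul_comm]

theorem lintegral_Ioi_mul_setLIntegral_le_le [SFinite μ] {g : α → ℝ} (hg : Measurable g)
    (hg0 : ∀ x, 0 ≤ g x) {G : α → ℝ≥0∞} (hG : AEMeasurable G μ) :
    2 * ∫⁻ t in Set.Ioi 0, ENNReal.ofReal t *
        ∫⁻ x in {x | g x ≤ t⁻¹}, ENNReal.ofReal (g x ^ 2) * G x ∂μ ≤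
      ∫⁻ x, G x ∂μ := by
  have hS : MeasurableSet {q : ℝ × α | g q.2 ≤ q.1⁻¹} :=
    measurableSet_le (by fun_prop) (by fun_prop)
  have hpow : AEMeasurable (fun x => ENNReal.ofReal (g x ^ 2)) μ := by fun_prop
  refine (congrArg (2 * ·) (lintegral_mul_setLIntegral_swap hS (by fun_prop)
    (hpow.mul hG))).trans_le ?_
  rw [← lintegral_const_mul' _ _ ENNReal.ofNat_ne_top]
  refine lintegral_mono fun x => ?_
  simp only [Set.mem_ofPred_eq, Pi.mul_apply]
  rw [mul_left_comm, mul_right_comm, mul_comm]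
  refine mul_le_of_le_one_right' ?_
  obtain hx | hx := (hg0 x).eq_or_lt
  · simp [← hx]
  · have hIoc : {t : ℝ | g x ≤ t⁻¹} ∩ Set.Ioi 0 = Set.Ioc 0 (g x)⁻¹ := by
      ext t
      exact ⟨fun ht => ⟨ht.2, le_inv_of_le_inv₀ hx ht.1⟩, fun ht =>
        ⟨le_inv_of_le_inv₀ ht.1 ht.2, ht.1⟩⟩
    have hlin := lintegral_Ioc_rpow (a := 1) (by norm_num) (inv_pos.2 hx).le
    simp only [Real.rpow_one] at hlin
    rw [Measure.restrict_restrict (measurableSet_le (by fun_prop) (by fun_prop)), hIoc, hlin,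
      ← ENNReal.ofReal_ofNat, ← ENNReal.ofReal_mul zero_le_two,
      ← ENNReal.ofReal_mul (by positivity), ENNReal.ofReal_le_one]
    norm_num
    field_simp
    norm_num

end WeakLp

section WeakType

variable {E : Type*} [NormedAddCommGroup E] [InnerProductSpace ℝ E] [FiniteDimensional ℝ E]
  [MeasurableSpace E] [BorelSpace E]

theorem ae_enorm_fourierInv_le (f : Lp (α := E) ℂ 2) :
    ∀ᵐ x, ‖(𝓕⁻ f : Lp (α := E) ℂ 2) x‖ₑ ≤ ∫⁻ ξ, ‖f ξ‖ₑ := by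
  by_cases hf : ∫⁻ ξ, ‖f ξ‖ₑ = ∞
  · exact ae_of_all _ fun x => hf ▸ le_top
  · filter_upwards [coeFn_fourierInv_ae_eq f ⟨Lp.aestronglyMeasurable f, lt_top_iff_ne_top.2 hf⟩]
      with x hx
    exact hx ▸ enorm_fourierInv_le _ x

theorem lintegral_enorm_fourierInv_sq (f : Lp (α := E) ℂ 2) :
    ∫⁻ x, ‖(𝓕⁻ f : Lp (α := E) ℂ 2) x‖ₑ ^ 2 = ∫⁻ ξ, ‖f ξ‖ₑ ^ 2 := by
  rw [← eLpNorm_two_sq, ← eLpNorm_two_sq, ← Lp.enorm_def, ← Lp.enorm_def, ← ofReal_norm,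
    ← ofReal_norm]
  exact congrArg (fun y => ENNReal.ofReal y ^ 2) ((Lp.fourierTransformₗᵢ E ℂ).symm.norm_map f)

theorem setLIntegral_enorm_fourierInv_add_sq_le (f g : Lp (α := E) ℂ 2 volume) (S : Set E) :
    ∫⁻ x in S, ‖(𝓕⁻ (f + g) : Lp (α := E) ℂ 2 volume) x‖ₑ ^ 2 ≤
      2 * (volume S * (∫⁻ ξ, ‖f ξ‖ₑ) ^ 2) + 2 * ∫⁻ ξ, ‖g ξ‖ₑ ^ 2 := by
  have hadd : 𝓕⁻ (f + g) = 𝓕⁻ f + (𝓕⁻ g : Lp (α := E) ℂ 2 volume) :=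
    (Lp.fourierTransformₗᵢ E ℂ).symm.map_add f g
  have hsq (a b : ℝ≥0∞) : (a + b) ^ 2 ≤ 2 * a ^ 2 + 2 * b ^ 2 := by
    have h := ENNReal.rpow_add_le_mul_rpow_add_rpow a b one_le_two
    norm_num at h
    rwa [mul_add] at h
  have hpoint : ∀ᵐ x, ‖(𝓕⁻ (f + g) : Lp (α := E) ℂ 2 volume) x‖ₑ ^ 2 ≤
      2 * (∫⁻ ξ, ‖f ξ‖ₑ) ^ 2 + 2 * ‖(𝓕⁻ g : Lp (α := E) ℂ 2 volume) x‖ₑ ^ 2 := by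
    rw [hadd]
    filter_upwards [ae_enorm_fourierInv_le f,
      Lp.coeFn_add (𝓕⁻ f) (𝓕⁻ g : Lp (α := E) ℂ 2 volume)] with x hx hxadd
    rw [hxadd, Pi.add_apply]
    refine le_trans ?_ (hsq _ _)
    gcongr
    exact (enorm_add_le _ _).trans (by gcongr)
  calc _ ≤ ∫⁻ x in S, (2 * (∫⁻ ξ, ‖f ξ‖ₑ) ^ 2 +
          2 * ‖(𝓕⁻ g : Lp (α := E) ℂ 2 volume) x‖ₑ ^ 2) :=
        lintegral_mono_ae (ae_restrict_of_ae hpoint)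
    _ = 2 * (volume S * (∫⁻ ξ, ‖f ξ‖ₑ) ^ 2) +
          2 * ∫⁻ x in S, ‖(𝓕⁻ g : Lp (α := E) ℂ 2 volume) x‖ₑ ^ 2 := by
        rw [lintegral_add_left measurable_const, setLIntegral_const,
          lintegral_const_mul' _ _ ENNReal.ofNat_ne_top]
        ring
    _ ≤ _ := by
        rw [← lintegral_enorm_fourierInv_sq]
        gcongr
        exact Measure.restrict_le_self

theorem setLIntegral_enorm_fourierInv_sq_le_add (w : Lp (α := E) ℂ 2) (S : Set E) {B : Set E}
    (hB : MeasurableSet B) :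
    ∫⁻ x in S, ‖(𝓕⁻ w : Lp (α := E) ℂ 2) x‖ₑ ^ 2 ≤
      2 * (volume S * (∫⁻ ξ in B, ‖w ξ‖ₑ) ^ 2) + 2 * ∫⁻ ξ in Bᶜ, ‖w ξ‖ₑ ^ 2 := by
  let low : Lp (α := E) ℂ 2 volume := ((Lp.memLp w).indicator hB).toLp
  let high : Lp (α := E) ℂ 2 volume := ((Lp.memLp w).indicator hB.compl).toLp
  have hlow : low =ᵐ[volume] B.indicator w := MemLp.coeFn_toLp _
  have hhigh : high =ᵐ[volume] Bᶜ.indicator w := MemLp.coeFn_toLp _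
  have hsum : low + high = w := by
    refine Lp.ext ?_
    filter_upwards [hlow, hhigh, Lp.coeFn_add low high] with ξ hl hh hadd
    rw [hadd, Pi.add_apply, hl, hh, ← Pi.add_apply, Set.indicator_self_add_compl]
  have hlow_int : ∫⁻ ξ, ‖low ξ‖ₑ = ∫⁻ ξ in B, ‖w ξ‖ₑ := by
    rw [← lintegral_indicator hB]
    refine lintegral_congr_ae ?_
    filter_upwards [hlow] with ξ hξ
    rw [hξ, enorm_indicator_eq_indicator_enorm]
  have hhigh_int : ∫⁻ ξ, ‖high ξ‖ₑ ^ 2 = ∫⁻ ξ in Bᶜ, ‖w ξ‖ₑ ^ 2 := by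
    rw [← lintegral_indicator hB.compl]
    refine lintegral_congr_ae ?_
    filter_upwards [hhigh] with ξ hξ
    rw [hξ]
    by_cases hB : ξ ∈ Bᶜ <;> simp [hB]
  rw [← hlow_int, ← hhigh_int, ← hsum]
  exact setLIntegral_enorm_fourierInv_add_sq_le low high S

variable {V : E → ℝ} {m : E → ℂ} {p : ℝ} {K L : ℝ≥0∞}

theorem HasWeakLpBound.setLIntegral_enorm_fourierInv_sq_le (hV : HasWeakLpBound V p K volume)
    (hm : HasWeakLpBound m p L volume) (hm_meas : Measurable m) (v : Lp (α := E) ℂ 2)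
    {w : Lp (α := E) ℂ 2} (hw : w =ᵐ[volume] fun ξ => m ξ * v ξ) {b t : ℝ} (hb : 0 < b)
    (hbp : b < p) (ht : 0 < t) :
    ∫⁻ x in {x | t < ‖V x‖}, ‖(𝓕⁻ w : Lp (α := E) ℂ 2) x‖ₑ ^ 2 ≤
      2 * K * L * (ENNReal.ofReal (p / (p - b)) * ENNReal.ofReal (t ^ (-b))) *
          (∫⁻ ξ in {ξ | t⁻¹ < ‖m ξ‖}, ENNReal.ofReal (‖m ξ‖ ^ (2 - b)) * ‖v ξ‖ₑ ^ 2) +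
        2 * ∫⁻ ξ in {ξ | ‖m ξ‖ ≤ t⁻¹}, ENNReal.ofReal (‖m ξ‖ ^ 2) * ‖v ξ‖ₑ ^ 2 := by
  let I : ℝ≥0∞ := ∫⁻ ξ in {ξ | t⁻¹ < ‖m ξ‖}, ENNReal.ofReal (‖m ξ‖ ^ (2 - b)) * ‖v ξ‖ₑ ^ 2
  let J : ℝ≥0∞ := ∫⁻ ξ in {ξ | ‖m ξ‖ ≤ t⁻¹}, ENNReal.ofReal (‖m ξ‖ ^ 2) * ‖v ξ‖ₑ ^ 2
  have hB : MeasurableSet {ξ | t⁻¹ < ‖m ξ‖} := measurableSet_lt measurable_const hm_meas.norm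
  have hBc : {ξ | t⁻¹ < ‖m ξ‖}ᶜ = {ξ | ‖m ξ‖ ≤ t⁻¹} := by
    ext ξ
    simp
  have hlow : ∫⁻ ξ in {ξ | t⁻¹ < ‖m ξ‖}, ‖w ξ‖ₑ = ∫⁻ ξ in {ξ | t⁻¹ < ‖m ξ‖}, ‖m ξ‖ₑ * ‖v ξ‖ₑ := by
    refine lintegral_congr_ae (ae_restrict_of_ae ?_)
    filter_upwards [hw] with ξ hξ
    rw [hξ, enorm_mul]
  have hhigh : ∫⁻ ξ in {ξ | ‖m ξ‖ ≤ t⁻¹}, ‖w ξ‖ₑ ^ 2 =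
      ∫⁻ ξ in {ξ | ‖m ξ‖ ≤ t⁻¹}, ENNReal.ofReal (‖m ξ‖ ^ 2) * ‖v ξ‖ₑ ^ 2 := by
    refine lintegral_congr_ae (ae_restrict_of_ae ?_)
    filter_upwards [hw] with ξ hξ
    rw [hξ, enorm_mul, mul_pow, ENNReal.ofReal_pow (norm_nonneg _), ofReal_norm]
  have hcoef : ENNReal.ofReal (t ^ (-p)) * ENNReal.ofReal (p / (p - b) * t⁻¹ ^ (b - p)) =
      ENNReal.ofReal (p / (p - b)) * ENNReal.ofReal (t ^ (-b)) := by
    have : 0 < p - b := sub_pos.2 hbp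
    have hp : 0 < p := hb.trans hbp
    rw [← ENNReal.ofReal_mul (by positivity), ← ENNReal.ofReal_mul (by positivity),
      Real.inv_rpow ht.le, ← Real.rpow_neg ht.le, mul_left_comm, ← Real.rpow_add ht]
    ring_nf
  calc _ ≤ 2 * (volume {x | t < ‖V x‖} * (∫⁻ ξ in {ξ | t⁻¹ < ‖m ξ‖}, ‖w ξ‖ₑ) ^ 2) +
          2 * ∫⁻ ξ in {ξ | t⁻¹ < ‖m ξ‖}ᶜ, ‖w ξ‖ₑ ^ 2 :=
        setLIntegral_enorm_fourierInv_sq_le_add w _ hB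
    _ ≤ 2 * (K * ENNReal.ofReal (t ^ (-p)) *
          (L * ENNReal.ofReal (p / (p - b) * t⁻¹ ^ (b - p)) * I)) + 2 * J := by
        rw [hBc, hlow, hhigh]
        gcongr
        · exact hV t ht
        · exact hm.sq_setLIntegral_mul_le hm_meas.aestronglyMeasurable
            (Lp.aestronglyMeasurable v).enorm hb hbp (inv_pos.2 ht)
    _ = 2 * K * L * (ENNReal.ofReal (t ^ (-p)) *
          ENNReal.ofReal (p / (p - b) * t⁻¹ ^ (b - p))) * I + 2 * J := by ring
    _ = _ := by rw [hcoef]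

theorem HasWeakLpBound.lintegral_enorm_mul_fourierInv_sq_le (hV : HasWeakLpBound V p K volume)
    (hV_meas : AEStronglyMeasurable V) (hm : HasWeakLpBound m p L volume) (hm_meas : Measurable m)
    (v : Lp (α := E) ℂ 2) {w : Lp (α := E) ℂ 2} (hw : w =ᵐ[volume] fun ξ => m ξ * v ξ) {b : ℝ}
    (hb : 2 < b) (hbp : b < p) :
    ∫⁻ x, ‖V x‖ₑ ^ 2 * ‖(𝓕⁻ w : Lp (α := E) ℂ 2) x‖ₑ ^ 2 ≤
      (2 + 4 * K * L * ENNReal.ofReal (p / (p - b)) * ENNReal.ofReal (1 / (b - 2))) *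
        ‖v‖ₑ ^ 2 := by
  have hG : AEMeasurable fun ξ => ‖v ξ‖ₑ ^ 2 := (Lp.aestronglyMeasurable v).enorm.pow_const 2
  let c : ℝ≥0∞ := 2 * K * L * ENNReal.ofReal (p / (p - b))
  let low (t : ℝ) : ℝ≥0∞ := ENNReal.ofReal (t ^ (1 - b)) *
    ∫⁻ ξ in {ξ | t⁻¹ < ‖m ξ‖}, ENNReal.ofReal (‖m ξ‖ ^ (2 - b)) * ‖v ξ‖ₑ ^ 2
  let high (t : ℝ) : ℝ≥0∞ := ENNReal.ofReal t *
    ∫⁻ ξ in {ξ | ‖m ξ‖ ≤ t⁻¹}, ENNReal.ofReal (‖m ξ‖ ^ 2) * ‖v ξ‖ₑ ^ 2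
  have hlevel : ∀ t ∈ Set.Ioi (0 : ℝ), ENNReal.ofReal t *
      ∫⁻ x in {x | t < ‖V x‖}, ‖(𝓕⁻ w : Lp (α := E) ℂ 2 volume) x‖ₑ ^ 2 ≤
      c * low t + 2 * high t := fun t ht => by
    have hexp : ENNReal.ofReal (t ^ (1 - b)) = ENNReal.ofReal t * ENNReal.ofReal (t ^ (-b)) := by
      rw [← ENNReal.ofReal_mul (le_of_lt ht), ← Real.rpow_one_add' (le_of_lt ht) (by linarith),
        sub_eq_add_neg]
    refine (mul_le_mul_right (hV.setLIntegral_enorm_fourierInv_sq_le hm hm_meas v hw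
      (zero_lt_two.trans hb) hbp ht) _).trans_eq ?_
    simp only [c, low, high, hexp]
    ring
  have hlow : ∫⁻ t in Set.Ioi 0, low t ≤ ENNReal.ofReal (1 / (b - 2)) * ∫⁻ ξ, ‖v ξ‖ₑ ^ 2 :=
    lintegral_Ioi_rpow_mul_setLIntegral_lt_le hm_meas.norm (fun _ => norm_nonneg _) hG hb
  have hhigh : 2 * ∫⁻ t in Set.Ioi 0, high t ≤ ∫⁻ ξ, ‖v ξ‖ₑ ^ 2 :=
    lintegral_Ioi_mul_setLIntegral_le_le hm_meas.norm (fun _ => norm_nonneg _) hG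
  have hlow_meas : AEMeasurable low (volume.restrict (Set.Ioi 0)) := by
    refine AEMeasurable.mul (by fun_prop) ?_
    refine aemeasurable_restrict_of_monotoneOn measurableSet_Ioi fun s hs t _ hst => ?_
    exact lintegral_mono_set fun ξ hξ => (inv_anti₀ hs hst).trans_lt hξ
  calc _ = 2 * ∫⁻ t in Set.Ioi 0, ENNReal.ofReal t *
          ∫⁻ x in {x | t < ‖V x‖}, ‖(𝓕⁻ w : Lp (α := E) ℂ 2 volume) x‖ₑ ^ 2 :=
        lintegral_enorm_sq_mul_eq_lintegral_setLIntegral_lt hV_meas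
          ((Lp.aestronglyMeasurable _).enorm.pow_const 2)
    _ ≤ 2 * ∫⁻ t in Set.Ioi 0, (c * low t + 2 * high t) :=
        mul_le_mul_right (setLIntegral_mono' measurableSet_Ioi hlevel) _
    _ = 2 * (c * (∫⁻ t in Set.Ioi 0, low t) + 2 * ∫⁻ t in Set.Ioi 0, high t) := by
        rw [lintegral_add_left' (hlow_meas.const_mul c), lintegral_const_mul'' _ hlow_meas,
          lintegral_const_mul' _ _ ENNReal.ofNat_ne_top]
    _ ≤ 2 * (c * (ENNReal.ofReal (1 / (b - 2)) * ∫⁻ ξ, ‖v ξ‖ₑ ^ 2) + ∫⁻ ξ, ‖v ξ‖ₑ ^ 2) := by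
        gcongr
    _ = _ := by
        rw [← eLpNorm_two_sq, ← Lp.enorm_def]
        ring

theorem exists_isMulComp_fourierMultiplier_of_hasWeakLpBound (hp : 2 < p)
    (hV : HasWeakLpBound V p K volume) (hV_meas : AEStronglyMeasurable V) (hK : K ≠ ∞)
    (hm : MemLp m ∞) (hm_weak : HasWeakLpBound m p L volume) (hL : L ≠ ∞) :
    ∃ T, IsMulComp V (fourierMultiplier hm) T := by
  obtain ⟨b, hb, hbp⟩ := exists_between hp
  refine exists_isMulComp_of_lintegral_le hV_meas
    (C := 2 + 4 * K * L * ENNReal.ofReal (p / (p - b)) * ENNReal.ofReal (1 / (b - 2)))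
    (by finiteness) fun u => ?_
  let m' : E → ℂ := hm.1.mk m
  have hmm' : m =ᵐ[volume] m' := hm.1.ae_eq_mk
  have hw : mulOp hm (𝓕 u) =ᵐ[volume] fun ξ => m' ξ * (𝓕 u : Lp (α := E) ℂ 2 volume) ξ := by
    filter_upwards [coeFn_mulOp hm (𝓕 u), hmm'] with ξ hξ hmξ
    rw [hξ, hmξ]
  have hnorm : ‖(𝓕 u : Lp (α := E) ℂ 2 volume)‖ₑ = ‖u‖ₑ := by
    rw [← ofReal_norm, Lp.norm_fourier_eq, ofReal_norm]
  exact hnorm ▸ hV.lintegral_enorm_mul_fourierInv_sq_le hV_meas (hm_weak.congr_ae hmm')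
    hm.1.stronglyMeasurable_mk.measurable (𝓕 u) hw hb hbp

end WeakType

section WeakLpEmbedding

variable {α F : Type*} [MeasurableSpace α] {μ : Measure α} [NormedAddCommGroup F] {f : α → F}
  {p q : ℝ} {K : ℝ≥0∞}

theorem hasWeakLpBound_eLpNorm (hp : 0 < p) (hf : AEStronglyMeasurable f μ) :
    HasWeakLpBound f p (eLpNorm f (ENNReal.ofReal p) μ ^ p) μ := fun t ht => by
  have hchebyshev := mul_meas_ge_le_pow_eLpNorm' μ (by simpa using hp) ENNReal.ofReal_ne_top
    hf (ENNReal.ofReal t)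
  rw [ENNReal.toReal_ofReal hp.le] at hchebyshev
  have hsub : {x | t < ‖f x‖} ⊆ {x | ENNReal.ofReal t ≤ ‖f x‖ₑ} := fun x hx => by
    rw [Set.mem_ofPred_eq, ← ofReal_norm]
    exact ENNReal.ofReal_le_ofReal (le_of_lt hx)
  have htp : 0 < t ^ p := Real.rpow_pos_of_pos ht p
  rw [Real.rpow_neg ht.le, ENNReal.ofReal_inv_of_pos htp, ← div_eq_mul_inv,
    ENNReal.le_div_iff_mul_le (by simp [htp]) (by simp), mul_comm,
    ← ENNReal.ofReal_rpow_of_pos ht]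
  exact (mul_le_mul_right (measure_mono hsub) _).trans hchebyshev

theorem exists_hasWeakLpBound_of_memLp (hp : 0 < p) (hf : MemLp f (ENNReal.ofReal p) μ) :
    ∃ K : ℝ≥0∞, K ≠ ∞ ∧ HasWeakLpBound f p K μ :=
  ⟨_, ENNReal.rpow_ne_top_of_nonneg hp.le hf.eLpNorm_ne_top, hasWeakLpBound_eLpNorm hp hf.1⟩

theorem HasWeakLpBound.mono_exponent (hf : HasWeakLpBound f p K μ) (hf₁ : ∀ x, ‖f x‖ ≤ 1)
    (hpq : p ≤ q) : HasWeakLpBound f q K μ := fun t ht => by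
  obtain ht₁ | ht₁ := lt_or_ge t 1
  · refine (hf t ht).trans ?_
    gcongr K * ENNReal.ofReal ?_
    exact Real.rpow_le_rpow_of_exponent_ge ht ht₁.le (neg_le_neg hpq)
  · have hempty : {x | t < ‖f x‖} = ∅ :=
      Set.eq_empty_of_forall_notMem fun x hx => ((hf₁ x).trans ht₁).not_gt hx
    simp [hempty]

theorem HasWeakLpBound.memLp_indicator (hf : HasWeakLpBound f p K μ) (hK : K ≠ ∞)
    (hfm : AEStronglyMeasurable f μ) (hq : 0 < q) (hqp : q < p) {s : ℝ} (hs : 0 < s) :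
    MemLp ({x | s < ‖f x‖}.indicator f) (ENNReal.ofReal q) μ := by
  have hS : NullMeasurableSet {x | s < ‖f x‖} μ :=
    nullMeasurableSet_lt aemeasurable_const hfm.norm.aemeasurable
  have hint := hf.setLIntegral_rpow_le hfm hq hqp hs
  refine ⟨hfm.indicator₀ hS, ?_⟩
  rw [eLpNorm_lt_top_iff_lintegral_rpow_enorm_lt_top (by simpa using hq) ENNReal.ofReal_ne_top,
    ENNReal.toReal_ofReal hq.le]
  refine lt_of_le_of_lt (le_of_eq_of_le ?_ hint)
    (ENNReal.mul_lt_top hK.lt_top ENNReal.ofReal_lt_top)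
  rw [← lintegral_indicator₀ hS]
  refine lintegral_congr fun x => ?_
  by_cases hx : x ∈ {x | s < ‖f x‖}
  · rw [Set.indicator_of_mem hx, Set.indicator_of_mem hx,
      ← ENNReal.ofReal_rpow_of_nonneg (norm_nonneg _) hq.le, ofReal_norm]
  · rw [Set.indicator_of_notMem hx, Set.indicator_of_notMem hx, enorm_zero,
      ENNReal.zero_rpow_of_pos hq]

theorem hasWeakLpBound_of_norm_mul_norm_le {E : Type*} [NormedAddCommGroup E] [NormedSpace ℝ E]
    [FiniteDimensional ℝ E] [MeasurableSpace E] [BorelSpace E] (μ : Measure E)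
    [μ.IsAddHaarMeasure] {f : E → F} {C : ℝ} (hC : 0 ≤ C) (hf : ∀ x, ‖f x‖ * ‖x‖ ≤ C) :
    HasWeakLpBound f (Module.finrank ℝ E)
      (ENNReal.ofReal (C ^ Module.finrank ℝ E) * μ (Metric.ball 0 1)) μ := fun t ht => by
  have hsub : {x | t < ‖f x‖} ⊆ Metric.closedBall 0 (C / t) := fun x hx => by
    rw [mem_closedBall_zero_iff, le_div_iff₀' ht]
    exact (mul_le_mul_of_nonneg_right (le_of_lt hx) (norm_nonneg x)).trans (hf x)
  refine (measure_mono hsub).trans_eq ?_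
  rw [Measure.addHaar_closedBall _ _ (by positivity), div_pow, div_eq_mul_inv,
    ENNReal.ofReal_mul (by positivity), Real.rpow_neg ht.le, Real.rpow_natCast, mul_right_comm]

end WeakLpEmbedding

section Approximation

variable {E F : Type*} [NormedAddCommGroup E] [InnerProductSpace ℝ E] [FiniteDimensional ℝ E]
  [MeasurableSpace E] [BorelSpace E] [NormedAddCommGroup F] [NormedSpace ℂ F]

theorem IsMulComp.isCompactOperator_fourierMultiplier_comp_of_approx {V : E → ℝ}
    {B T : F →L[ℂ] Lp (α := E) ℂ 2 volume} (hT : IsMulComp V B T) (hV : AEStronglyMeasurable V)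
    (happrox : ∀ ε > 0, ∃ W : E → ℝ, MemLp W 2 ∧ ∀ᵐ x, ‖V x - W x‖ ≤ ε) {m : E → ℂ}
    (hm : MemLp m ∞) (hm₀ : Tendsto m (cocompact E) (𝓝 0)) :
    IsCompactOperator (fourierMultiplier hm ∘L T) := by
  refine isCompactOperator_of_forall_exists_norm_sub_le fun ε hε => ?_
  obtain ⟨δ, hδ, hδε⟩ := exists_pos_mul_lt hε (‖fourierMultiplier hm‖ * ‖B‖)
  obtain ⟨W, hW, hVW⟩ := happrox δ hδ
  have hWV : ∀ᵐ x, ‖(W - V) x‖ ≤ δ := by simpa only [Pi.sub_apply, norm_sub_rev] using hVW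
  have hR : MemLp (W - V) ∞ := memLp_top_of_bound (hW.1.sub hV) δ hWV
  let R : F →L[ℂ] Lp (α := E) ℂ 2 volume := mulOp hR.ofReal ∘L B
  have hTR : IsMulComp W B (T + R) := by
    simpa only [add_sub_cancel] using hT.add (isMulComp_mulOp_comp hR B)
  refine ⟨_, hTR.isCompactOperator_fourierMultiplier_comp hW hm hm₀, ?_⟩
  calc ‖fourierMultiplier hm ∘L T - fourierMultiplier hm ∘L (T + R)‖
      = ‖fourierMultiplier hm ∘L R‖ := by
        rw [ContinuousLinearMap.comp_add, sub_add_cancel_left, norm_neg]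
    _ ≤ ‖fourierMultiplier hm‖ * (δ * ‖B‖) := by
        refine (opNorm_comp_le _ _).trans ?_
        gcongr
        refine (opNorm_comp_le _ _).trans ?_
        gcongr
        exact norm_mulOp_le _ hδ.le (hWV.mono fun x hx => (Complex.norm_real _).trans_le hx)
    _ ≤ ε := by linarith

end Approximation

section InvSqrtSymbol

variable {d : ℕ}

theorem norm_invSqrtSymbol (ξ : RSpace d) :
    ‖invSqrtSymbol d ξ‖ = (√(1 + (2 * Real.pi * ‖ξ‖) ^ 2))⁻¹ := by
  rw [invSqrtSymbol, Complex.norm_real, Real.norm_of_nonneg (by positivity),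
    Real.rpow_neg (by positivity), Real.sqrt_eq_rpow]

theorem norm_invSqrtSymbol_le_one (ξ : RSpace d) : ‖invSqrtSymbol d ξ‖ ≤ 1 := by
  rw [norm_invSqrtSymbol]
  exact inv_le_one_of_one_le₀ (Real.one_le_sqrt.2 (le_add_of_nonneg_right (sq_nonneg _)))

theorem le_two_pi_mul_self {r : ℝ} (hr : 0 ≤ r) : r ≤ 2 * Real.pi * r :=
  le_mul_of_one_le_left hr (by linarith [Real.pi_gt_three])

theorem norm_invSqrtSymbol_mul_norm_le_one (ξ : RSpace d) : ‖invSqrtSymbol d ξ‖ * ‖ξ‖ ≤ 1 := by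
  rw [norm_invSqrtSymbol, inv_mul_le_one₀ (by positivity)]
  refine Real.le_sqrt_of_sq_le ((pow_le_pow_left₀ (norm_nonneg ξ) ?_ 2).trans
    (le_add_of_nonneg_left zero_le_one))
  exact le_two_pi_mul_self (norm_nonneg ξ)

theorem tendsto_invSqrtSymbol_cocompact (d : ℕ) :
    Tendsto (invSqrtSymbol d) (cocompact (RSpace d)) (𝓝 0) := by
  have hnorm := tendsto_norm_cocompact_atTop (E := RSpace d)
  refine squeeze_zero_norm' ?_ (tendsto_inv_atTop_zero.comp hnorm)
  filter_upwards [hnorm.eventually_gt_atTop 0] with ξ hξ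
  exact (le_inv_mul_iff₀' hξ).2 (norm_invSqrtSymbol_mul_norm_le_one ξ) |>.trans_eq (mul_one _)

theorem hasWeakLpBound_invSqrtSymbol {p : ℝ} (hd : (d : ℝ) ≤ p) :
    HasWeakLpBound (invSqrtSymbol d) p (volume (Metric.ball (0 : RSpace d) 1)) volume := by
  have h := hasWeakLpBound_of_norm_mul_norm_le volume zero_le_one
    (norm_invSqrtSymbol_mul_norm_le_one (d := d))
  rw [finrank_euclideanSpace_fin, one_pow, ENNReal.ofReal_one, one_mul] at h
  exact h.mono_exponent norm_invSqrtSymbol_le_one hd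

theorem memLp_two_invSqrtSymbol (hd : d < 2) : MemLp (invSqrtSymbol d) 2 := by
  have hmeas : AEStronglyMeasurable (invSqrtSymbol d) := (memLp_invSqrtSymbol d).1
  rw [memLp_two_iff_integrable_sq_norm hmeas]
  have hint := integrable_rpow_neg_one_add_norm_sq (E := RSpace d) (μ := volume) (r := 2)
    (by rw [finrank_euclideanSpace_fin]; exact_mod_cast hd)
  refine hint.mono' (hmeas.norm.pow 2) (ae_of_all _ fun ξ => ?_)
  rw [norm_invSqrtSymbol, Real.norm_of_nonneg (by positivity), inv_pow,
    Real.sq_sqrt (by positivity), neg_div_self two_ne_zero, Real.rpow_neg_one]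
  gcongr
  exact le_two_pi_mul_self (norm_nonneg ξ)

end InvSqrtSymbol

section Potential

variable {d : ℕ} {V : RSpace d → ℝ} {p : ℝ} {K : ℝ≥0∞}

theorem MemWeakLp.exists_hasWeakLpBound (hV : MemWeakLp V p) :
    ∃ K : ℝ≥0∞, K ≠ ∞ ∧ HasWeakLpBound V p K volume := by
  obtain ⟨-, c, hc, hVc⟩ := hV
  refine ⟨ENNReal.ofReal (c ^ p), ENNReal.ofReal_ne_top, fun t ht => (hVc t ht).trans_eq ?_⟩
  rw [div_eq_mul_inv, Real.rpow_neg ht.le, ENNReal.ofReal_mul (by positivity)]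

theorem memLpAddLinfZero_iff {p : ℝ≥0∞} : MemLpAddLinfZero V p ↔
    AEStronglyMeasurable V volume ∧
      ∀ ε > 0, ∃ W : RSpace d → ℝ, MemLp W p ∧ ∀ᵐ x, ‖V x - W x‖ ≤ ε := by
  refine and_congr_right fun _ => ⟨fun ⟨W, hW, hlim⟩ ε hε => ?_, fun h => ?_⟩
  · obtain ⟨n, hn⟩ := (hlim.eventually_lt_const (ENNReal.ofReal_pos.2 hε)).exists
    refine ⟨W n, hW n, ?_⟩
    rw [eLpNorm_exponent_top] at hn
    filter_upwards [ae_le_eLpNormEssSup (f := V - W n)] with x hx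
    have hxε := hx.trans hn.le
    rwa [← ofReal_norm, ENNReal.ofReal_le_ofReal_iff hε.le] at hxε
  · choose W hW hVW using fun n : ℕ => h (1 / ((n : ℝ) + 1)) Nat.one_div_pos_of_nat
    refine ⟨W, hW, tendsto_of_tendsto_of_tendsto_of_le_of_le tendsto_const_nhds ?_
      (fun _ => zero_le) fun n => eLpNormEssSup_le_of_ae_bound (hVW n)⟩
    simpa using ENNReal.tendsto_ofReal tendsto_one_div_add_atTop_nhds_zero_nat

theorem MemLpAddLinfZero.of_forall_memLp {p q : ℝ≥0∞} (hV : MemLpAddLinfZero V p)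
    (h : ∀ W : RSpace d → ℝ, MemLp W p → MemLpAddLinfZero W q) : MemLpAddLinfZero V q := by
  refine memLpAddLinfZero_iff.2 ⟨hV.1, fun ε hε => ?_⟩
  obtain ⟨W, hW, hVW⟩ := (memLpAddLinfZero_iff.1 hV).2 (ε / 2) (half_pos hε)
  obtain ⟨U, hU, hWU⟩ := (memLpAddLinfZero_iff.1 (h W hW)).2 (ε / 2) (half_pos hε)
  refine ⟨U, hU, ?_⟩
  filter_upwards [hVW, hWU] with x hx hx'
  linarith [norm_sub_le_norm_sub_add_norm_sub (V x) (W x) (U x)]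

theorem HasWeakLpBound.memLpAddLinfZero (hV : HasWeakLpBound V p K volume) (hK : K ≠ ∞)
    (hV_meas : AEStronglyMeasurable V) {q : ℝ} (hq : 0 < q) (hqp : q < p) :
    MemLpAddLinfZero V (ENNReal.ofReal q) := by
  refine memLpAddLinfZero_iff.2 ⟨hV_meas, fun ε hε =>
    ⟨_, hV.memLp_indicator hK hV_meas hq hqp hε, ae_of_all _ fun x => ?_⟩⟩
  by_cases hx : ε < ‖V x‖
  · rw [Set.indicator_of_mem (show x ∈ {x | ε < ‖V x‖} from hx), sub_self, norm_zero]
    exact hε.le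
  · rw [Set.indicator_of_notMem (show x ∉ {x | ε < ‖V x‖} from hx), sub_zero]
    exact not_lt.1 hx

theorem potentialBounded_iff :
    PotentialBounded V ↔ ∃ T, IsMulComp V (fourierMultiplier (memLp_invSqrtSymbol d)) T :=
  Iff.rfl

theorem MemLpAddLinfZero.potentialBounded {p : ℝ≥0∞} (hV : MemLpAddLinfZero V p)
    (h : ∀ W : RSpace d → ℝ, MemLp W p → PotentialBounded W) : PotentialBounded V := by
  obtain ⟨W, hW, hVW⟩ := (memLpAddLinfZero_iff.1 hV).2 1 one_pos
  obtain ⟨T, hT⟩ := h W hW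
  have hR : MemLp (V - W) ∞ := memLp_top_of_bound (hV.1.sub hW.1) 1 hVW
  rw [← add_sub_cancel W V]
  exact ⟨_, IsMulComp.add hT (isMulComp_mulOp_comp hR _)⟩

theorem PotentialBounded.potentialCompact (hVb : PotentialBounded V)
    (hV : MemLpAddLinfZero V 2) : PotentialCompact V := by
  obtain ⟨T, hT⟩ := hVb
  obtain ⟨hV_meas, happrox⟩ := memLpAddLinfZero_iff.1 hV
  exact ⟨invSqrtLaplacian d ∘L T,
    IsMulComp.isCompactOperator_fourierMultiplier_comp_of_approx hT hV_meas happrox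
      (memLp_invSqrtSymbol d) (tendsto_invSqrtSymbol_cocompact d), fun u => ⟨T u, hT u, rfl⟩⟩

theorem potentialBounded_of_memLp_two (hd : d < 2) (hV : MemLp V 2) : PotentialBounded V :=
  potentialBounded_iff.2 <| (exists_isMulComp_fourierMultiplier_of_memLp_two hV
    (memLp_invSqrtSymbol d) (memLp_two_invSqrtSymbol hd)).imp fun _ => And.left

theorem HasWeakLpBound.potentialBounded (hV : HasWeakLpBound V p K volume) (hK : K ≠ ∞)
    (hV_meas : AEStronglyMeasurable V) (hp : 2 < p) (hd : (d : ℝ) ≤ p) : PotentialBounded V :=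
  potentialBounded_iff.2 <| exists_isMulComp_fourierMultiplier_of_hasWeakLpBound hp hV hV_meas hK
    (memLp_invSqrtSymbol d) (hasWeakLpBound_invSqrtSymbol hd) measure_ball_lt_top.ne

theorem HasWeakLpBound.memLpAddLinfZero_two (hV : HasWeakLpBound V p K volume) (hK : K ≠ ∞)
    (hV_meas : AEStronglyMeasurable V) (hp : 2 < p) : MemLpAddLinfZero V 2 := by
  simpa using hV.memLpAddLinfZero hK hV_meas two_pos hp

theorem MemLpAddLinfZero.potentialBounded_and_potentialCompact_of_lt_two (hd : d < 2)
    (hV : MemLpAddLinfZero V 2) : PotentialBounded V ∧ PotentialCompact V :=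
  have hVb := hV.potentialBounded fun _ => potentialBounded_of_memLp_two hd
  ⟨hVb, hVb.potentialCompact hV⟩

theorem HasWeakLpBound.potentialBounded_and_potentialCompact (hV : HasWeakLpBound V p K volume)
    (hK : K ≠ ∞) (hV_meas : AEStronglyMeasurable V) (hp : 2 < p) (hd : (d : ℝ) ≤ p) :
    PotentialBounded V ∧ PotentialCompact V :=
  have hVb := hV.potentialBounded hK hV_meas hp hd
  ⟨hVb, hVb.potentialCompact (hV.memLpAddLinfZero_two hK hV_meas hp)⟩

theorem MemWeakLp.potentialBounded_and_potentialCompact (hp : 2 < p) (hd : (d : ℝ) ≤ p)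
    (hV : MemWeakLp V p) : PotentialBounded V ∧ PotentialCompact V :=
  let ⟨_, hK, hVK⟩ := hV.exists_hasWeakLpBound
  hVK.potentialBounded_and_potentialCompact hK hV.1 hp hd

theorem MemLpAddLinfZero.potentialBounded_and_potentialCompact (hp : 2 < p) (hd : (d : ℝ) ≤ p)
    (hV : MemLpAddLinfZero V (ENNReal.ofReal p)) : PotentialBounded V ∧ PotentialCompact V := by
  have hVb : PotentialBounded V := hV.potentialBounded fun W hW => by
    obtain ⟨K, hK, hWK⟩ := exists_hasWeakLpBound_of_memLp (two_pos.trans hp) hW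
    exact hWK.potentialBounded hK hW.1 hp hd
  refine ⟨hVb, hVb.potentialCompact <| hV.of_forall_memLp fun W hW => ?_⟩
  obtain ⟨K, hK, hWK⟩ := exists_hasWeakLpBound_of_memLp (two_pos.trans hp) hW
  exact hWK.memLpAddLinfZero_two hK hW.1 hp

theorem potentialBounded_and_potentialCompact_const_div_norm (hd : 3 ≤ d) (c : ℝ) :
    PotentialBounded (fun x : RSpace d => c / ‖x‖) ∧
      PotentialCompact fun x : RSpace d => c / ‖x‖ := by
  have hbound (x : RSpace d) : ‖c / ‖x‖‖ * ‖x‖ ≤ ‖c‖ := by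
    rw [norm_div, norm_norm]
    obtain hx | hx := (norm_nonneg x).eq_or_lt
    · rw [← hx, mul_zero]
      exact norm_nonneg c
    · rw [div_mul_cancel₀ _ hx.ne']
  have hweak := hasWeakLpBound_of_norm_mul_norm_le volume (norm_nonneg c) hbound
  have hmeas : Measurable fun x : RSpace d => c / ‖x‖ := by fun_prop
  rw [finrank_euclideanSpace_fin] at hweak
  refine hweak.potentialBounded_and_potentialCompact ?_ hmeas.aestronglyMeasurable ?_ le_rfl
  · exact ENNReal.mul_ne_top ENNReal.ofReal_ne_top measure_ball_lt_top.ne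
  · exact_mod_cast hd

end Potential

theorem mainTheorem6_general (d : ℕ) :
    (d < 2 → ∀ V : RSpace d → ℝ, MemLpAddLinfZero V 2 →
      PotentialBounded V ∧ PotentialCompact V) ∧
    (∀ p : ℝ, 2 < p → (d : ℝ) ≤ p → ∀ V : RSpace d → ℝ,
      MemLpAddLinfZero V (ENNReal.ofReal p) ∨ MemWeakLp V p →
      PotentialBounded V ∧ PotentialCompact V) ∧
    (3 ≤ d → ∀ c : ℝ, PotentialEven (fun x : RSpace d => c / ‖x‖) ∧
      PotentialBounded (fun x : RSpace d => c / ‖x‖) ∧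
      PotentialCompact (fun x : RSpace d => c / ‖x‖)) :=
  ⟨fun hd _ hV => hV.potentialBounded_and_potentialCompact_of_lt_two hd,
    fun _ hp hd _ hV => hV.elim (·.potentialBounded_and_potentialCompact hp hd)
      (·.potentialBounded_and_potentialCompact hp hd),
    fun hd c => ⟨fun x => by simp only [norm_neg],
      potentialBounded_and_potentialCompact_const_div_norm hd c⟩⟩

end

theorem mainTheorem6 :
    -- dimension one
    (∀ V : RSpace 1 → ℝ, MemLpAddLinfZero V 2 →
      PotentialBounded V ∧ PotentialCompact V) ∧
    -- dimension two
    (∀ (p : ℝ) (V : RSpace 2 → ℝ), 2 < p → MemLpAddLinfZero V (ENNReal.ofReal p) →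
      PotentialBounded V ∧ PotentialCompact V) ∧
    -- dimension at least three
    (∀ (d : ℕ) (V : RSpace d → ℝ), 3 ≤ d → MemWeakLp V (d : ℝ) →
      PotentialBounded V ∧ PotentialCompact V) ∧
    -- the repulsive and attractive Coulomb potentials in dimension three
    (∀ V : RSpace 3 → ℝ, (V = fun x => 1 / ‖x‖) ∨ (V = fun x => -(1 / ‖x‖)) →
      PotentialEven V ∧ PotentialBounded V ∧ PotentialCompact V) := by
  refine ⟨(mainTheorem6_general 1).1 one_lt_two, fun p V hp hV =>
    (mainTheorem6_general 2).2.1 p hp (by exact_mod_cast hp.le) V (.inl hV), fun d V hd hV =>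
    (mainTheorem6_general d).2.1 d (by exact_mod_cast hd) le_rfl V (.inr hV), ?_⟩
  rintro V (rfl | rfl)
  · exact (mainTheorem6_general 3).2.2 le_rfl 1
  · simpa only [neg_div] using (mainTheorem6_general 3).2.2 le_rfl (-1)
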